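/- Let $q$ be a prime power, let $\mathcal R=\mathbb F_{q^2}[x,y]$ with $y^q+y=x^{q+1}$ be the ring of functions on the Hermitian curve that are regular outside the place at infinity $P_\infty$, and let $\mathcal P^\star$ be the set of the $n=q^3$ affine rational points $P=(\alpha,\beta)$, $\beta^q+\beta=\alpha^{q+1}$, of the curve. For $f\in\mathcal R$ let $\operatorname{ord}(f)=-v_{P_\infty}(f)$ be its pole order at $P_\infty$ ($\operatorname{ord}(0)=-\infty$), and for $Q=\sum_t Q_tz^t\in\mathcal R[z]$ let $\operatorname{ord}_m(Q)=\max_t\{\operatorname{ord}(Q_t)+tm\}$. Let $m\ge 0$ and $0\le s\le \ell$ be integers, let $(r_P)_{P\in\mathcal P^\star}$ be elements of $\mathbb F_{q^2}$, let $R\in\mathcal R$ be any function with $R(P)=r_P$ for all $P\in\mathcal P^\star$, and let $G=x^{q^2}-x$. Say that $Q\in\mathcal R[z]$ has a zero of multiplicity at least $s$ at $(P,z_0)$, $P=(\alpha,\beta)$, if in its expansion $Q=\sum_{j,h\ge 0}\gamma_{j,h}\,\phi^j(z-z_0)^h$, with $\phi=x-\alpha$ as local parameter at $P$, one has $\gamma_{j,h}=0$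 whenever $j+h<s$. Let $\mathcal M_{s,\ell}$ be the $\mathcal R$-module of all $Q\in\mathcal R[z]$ with $\deg_zQ\le\ell$ that have a zero of multiplicity at least $s$ at $(P,r_P)$ for all $P\in\mathcal P^\star$. Put $$H^{(t)}=G^{s-t}(z-R)^t\quad(0\le t\le s),\qquad H^{(t)}=z^{t-s}(z-R)^s\quad(s<t\le\ell).$$ For $g=\sum_{j=0}^{q-1}g_j(x)y^j\in\mathcal R$ let $\nu(g)=(g_0,\dots,g_{q-1})\in\mathbb F_{q^2}[x]^q$, and for $Q=\sum_{t=0}^{\ell}Q_tz^t\in\mathcal R[z]$ let $\nu_z(Q)=(\nu(Q_0)\mid\dots\mid\nu(Q_\ell))\in\mathbb F_{q^2}[x]^{(\ell+1)q}$. Let $A_{s,\ell}$ be the square matrix over $\mathbb F_{q^2}[x]$ whose $(\ell+1)q$ rows are $\nu_z(y^jH^{(t)})$, $0\le t\le\ell$, $0\le j<q$. Let $w$ be the weight vector with entry $w_{t,j}=tm+j(q+1)$ at position $j$ of block $t$, and let the weighted degree of a vector $v=(v_{t,j})$ be the maximum of the degrees of the polynomials $x^{w_{t,j}}v_{t,j}(x^q)$,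 that is, $\max_{t,j}\{w_{t,j}+q\deg v_{t,j}\}$. Then $\nu_z$ restricts to a bijection from $\mathcal M_{s,\ell}$ onto the $\mathbb F_{q^2}[x]$-row space of $A_{s,\ell}$. Moreover, if $Q\in\mathcal R[z]$ with $\deg_zQ\le\ell$ is such that $\nu_z(Q)$ is a non-zero vector of this row space of minimal weighted degree among the non-zero vectors of the row space, then $Q$ is a non-zero element of $\mathcal M_{s,\ell}$, and $\operatorname{ord}_m(Q)$ is minimal among all non-zero elements of $\mathcal M_{s,\ell}$. -/

import Mathlib

open Polynomial

namespace Hermitian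

noncomputable section

/-! ### Arithmetic of `q` in a field with `q ^ 2` elements -/

theorem one_lt_q (K : Type*) [Field K] [Finite K] (q : ℕ) [hK : Fact (Nat.card K = q ^ 2)] :
    1 < q := by
  have h1 : 1 < Nat.card K := Finite.one_lt_card
  rw [hK.out] at h1
  by_contra h
  interval_cases q <;> simp at h1

theorem exists_char_pow (K : Type*) [Field K] [Finite K] (q : ℕ)
    [hK : Fact (Nat.card K = q ^ 2)] :
    ∃ p k : ℕ, p.Prime ∧ CharP K p ∧ q = p ^ k := by
  classical
  have := Fintype.ofFinite K
  obtain ⟨p, hp⟩ := CharP.exists K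
  obtain ⟨n, hpp, hn⟩ := FiniteField.card K p
  have h : p ^ (n : ℕ) = q ^ 2 := by rw [← hn, ← hK.out, Nat.card_eq_fintype_card]
  have hd : q ∣ p ^ (n : ℕ) := h ▸ dvd_pow_self q two_ne_zero
  obtain ⟨k, -, hk⟩ := (Nat.dvd_prime_pow hpp).1 hd
  exact ⟨p, k, hpp, hp, hk⟩

theorem add_pow_q (K : Type*) [Field K] [Finite K] (q : ℕ) [Fact (Nat.card K = q ^ 2)]
    {S : Type*} [CommRing S] [Algebra K S] (a b : S) :
    (a + b) ^ q = a ^ q + b ^ q := by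
  obtain ⟨p, k, hp, hc, rfl⟩ := exists_char_pow K q
  have := Fact.mk hp
  rcases subsingleton_or_nontrivial S with h | h
  · exact Subsingleton.elim _ _
  · have : CharP S p := charP_of_injective_algebraMap (algebraMap K S).injective p
    exact add_pow_char_pow a b p k

theorem neg_pow_q (K : Type*) [Field K] [Finite K] (q : ℕ) [Fact (Nat.card K = q ^ 2)]
    {S : Type*} [CommRing S] [Algebra K S] (a : S) : (-a) ^ q = -a ^ q := by
  have h := add_pow_q K q a (-a)
  rw [add_neg_cancel, zero_pow (by have := one_lt_q K q; omega)] at h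
  exact (neg_eq_of_add_eq_zero_right h.symm).symm

/-! ### The ring of functions `𝓡 = K[x, y]` -/

variable (K : Type*) [Field K] (q : ℕ)

/-- The polynomial `Y ^ q + Y - X ^ (q + 1)`, as a polynomial in `Y` over `K[X]`. -/
def curve : K[X][X] := X ^ q + X - C (X ^ (q + 1))

/-- `𝓡 = K[x, y]` with `y ^ q + y = x ^ (q + 1)`. -/
abbrev FunRing : Type _ := AdjoinRoot (curve K q)

/-- The function `x`. -/
def x : FunRing K q := AdjoinRoot.of (curve K q) X

/-- The function `y`. -/
def y : FunRing K q := AdjoinRoot.root (curve K q)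

/-- The affine rational places, identified with the rational points of the affine curve. -/
abbrev AffinePlace : Type _ := {P : K × K // P.2 ^ q + P.2 = P.1 ^ (q + 1)}

theorem curve_monic [Finite K] [Fact (Nat.card K = q ^ 2)] : (curve K q).Monic := by
  have h1 := one_lt_q K q
  have : curve K q = X ^ q + (X - C (X ^ (q + 1))) := by rw [curve]; ring
  rw [this]
  apply monic_X_pow_add
  rw [degree_X_sub_C]
  exact_mod_cast h1

theorem curve_natDegree [Finite K] [Fact (Nat.card K = q ^ 2)] : (curve K q).natDegree = q := by
  have h1 := one_lt_q K q
  have : curve K q = X ^ q + (X - C (X ^ (q + 1))) := by rw [curve]; ring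
  rw [this, natDegree_add_eq_left_of_natDegree_lt]
  · exact natDegree_X_pow q
  · rw [natDegree_X_pow, natDegree_X_sub_C]; exact h1

variable {K q}

/-- The homomorphism of `K`-algebras (as rings) out of `𝓡` with prescribed images of
`x` and `y`. -/
def liftXY {S : Type*} [CommRing S] [Algebra K S] (a b : S) (h : b ^ q + b = a ^ (q + 1)) :
    FunRing K q →+* S :=
  AdjoinRoot.lift (aeval a : K[X] →ₐ[K] S).toRingHom b (by
    rw [curve, eval₂_sub, eval₂_add, eval₂_X_pow, eval₂_X, eval₂_C]; simp [h])

/-- The value of `f ∈ 𝓡` at an affine place. -/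
def evalAt (P : AffinePlace K q) : FunRing K q →+* K := liftXY P.1.1 P.1.2 P.2

/-! ### Expansions at the places -/

/-- For `c` without constant term: the series `∑ i, (-1) ^ i * c ^ (q ^ i)`, that is, the solution
`w` of `w ^ q + w = c` without constant term (the terms with `i > n` do not contribute to the
coefficient of index `n`). -/
def solve (q : ℕ) (c : PowerSeries K) : PowerSeries K :=
  PowerSeries.mk fun n =>
    PowerSeries.coeff n (∑ i ∈ Finset.range (n + 1), (-1) ^ i * c ^ (q ^ i))

section

variable [Finite K] [Fact (Nat.card K = q ^ 2)]

theorem X_pow_dvd_solve_sub {c : PowerSeries K} (hc : PowerSeries.constantCoeff c = 0) (N : ℕ) :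
    (PowerSeries.X : PowerSeries K) ^ N ∣
      solve q c - ∑ i ∈ Finset.range N, (-1) ^ i * c ^ (q ^ i) := by
  rw [PowerSeries.X_pow_dvd_iff]
  intro n hn
  have hX : (PowerSeries.X : PowerSeries K) ∣ c := PowerSeries.X_dvd_iff.2 hc
  rw [map_sub, solve, PowerSeries.coeff_mk, sub_eq_zero, map_sum, map_sum]
  refine Finset.sum_subset (Finset.range_subset_range.2 hn) ?_
  intro i _ hi
  have hi' : n < i := by simpa using hi
  have h2 : (PowerSeries.X : PowerSeries K) ^ (q ^ i) ∣ (-1) ^ i * c ^ (q ^ i) :=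
    (pow_dvd_pow_of_dvd hX _).mul_left _
  exact PowerSeries.X_pow_dvd_iff.1 h2 n (hi'.trans (Nat.lt_pow_self (one_lt_q K q)))

theorem solve_spec {c : PowerSeries K} (hc : PowerSeries.constantCoeff c = 0) :
    solve q c ^ q + solve q c = c := by
  have hX : (PowerSeries.X : PowerSeries K) ∣ c := PowerSeries.X_dvd_iff.2 hc
  have hq := one_lt_q K q
  have key : ∀ N : ℕ, (∑ i ∈ Finset.range N, (-1) ^ i * c ^ (q ^ i)) ^ q
      + ∑ i ∈ Finset.range N, (-1) ^ i * c ^ (q ^ i) = c - (-1) ^ N * c ^ (q ^ N) := by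
    intro N
    induction N with
    | zero => simp [zero_pow (by omega : q ≠ 0)]
    | succ N ih =>
      have hs : (((-1) ^ N * c ^ (q ^ N) : PowerSeries K)) ^ q = (-1) ^ N * c ^ (q ^ (N + 1)) := by
        rw [mul_pow, ← pow_mul (c), ← pow_succ, ← pow_mul, mul_comm N q, pow_mul, neg_pow_q K q,
          one_pow]
      rw [Finset.sum_range_succ, add_pow_q K q, hs, pow_succ (-1 : PowerSeries K) N]
      linear_combination ih
  ext n
  have hd := X_pow_dvd_solve_sub (q := q) hc (n + 1)
  set S := ∑ i ∈ Finset.range (n + 1), (-1) ^ i * c ^ (q ^ i) with hS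
  have h3 : (PowerSeries.X : PowerSeries K) ^ (n + 1) ∣ solve q c ^ q + solve q c - c := by
    have e : solve q c ^ q + solve q c - c
        = (solve q c ^ q - S ^ q) + (solve q c - S) - (-1) ^ (n + 1) * c ^ (q ^ (n + 1)) := by
      linear_combination key (n + 1)
    rw [e]
    refine dvd_sub (dvd_add (hd.trans (sub_dvd_pow_sub_pow _ _ q)) hd) ?_
    refine Dvd.dvd.mul_left ?_ _
    exact (pow_dvd_pow _ (Nat.lt_pow_self hq).le).trans (pow_dvd_pow_of_dvd hX _)
  have := PowerSeries.X_pow_dvd_iff.1 h3 n (Nat.lt_succ_self n)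
  rwa [map_sub, sub_eq_zero] at this

theorem solve_ne_zero {c : PowerSeries K} (hc : PowerSeries.constantCoeff c = 0) (h0 : c ≠ 0) :
    solve q c ≠ 0 := by
  intro h
  have := solve_spec (q := q) hc
  rw [h, zero_pow (by have := one_lt_q K q; omega), add_zero] at this
  exact h0 this.symm

/-- The power series of `y` at the affine place `P = (α, β)` in the local parameter
`φ = x - α`. -/
def ySeries (P : AffinePlace K q) : PowerSeries K :=
  PowerSeries.C P.1.2 +
    solve q ((PowerSeries.C P.1.1 + PowerSeries.X) ^ (q + 1) - PowerSeries.C P.1.1 ^ (q + 1))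

theorem ySeries_spec (P : AffinePlace K q) :
    ySeries P ^ q + ySeries P = (PowerSeries.C P.1.1 + PowerSeries.X) ^ (q + 1) := by
  have h := solve_spec (K := K) (q := q)
    (c := (PowerSeries.C P.1.1 + PowerSeries.X) ^ (q + 1) - PowerSeries.C P.1.1 ^ (q + 1))
    (by simp)
  have hP := congrArg (PowerSeries.C (R := K)) P.2
  rw [map_add, map_pow, map_pow] at hP
  rw [ySeries, add_pow_q K q]
  linear_combination h + hP

/-- The expansion of the functions in `𝓡` at the affine place `P = (α, β)` as power series in the
local parameter `φ = x - α` (the variable of the power series ring). -/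
def expansionAt (P : AffinePlace K q) : FunRing K q →+* PowerSeries K :=
  liftXY (PowerSeries.C P.1.1 + PowerSeries.X) (ySeries P) (ySeries_spec P)

/-- `Q ∈ 𝓡[z]` has a zero of multiplicity at least `s` at `(P, z₀)`: in the expansion
`Q = ∑ γ j h * φ ^ j * (z - z₀) ^ h` all `γ j h` with `j + h < s` vanish. -/
def HasZeroOfMult (s : ℕ) (P : AffinePlace K q) (z₀ : K) (Q : (FunRing K q)[X]) : Prop :=
  ∀ j h : ℕ, j + h < s →
    PowerSeries.coeff j ((taylor (PowerSeries.C z₀) (Q.map (expansionAt P))).coeff h) = 0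

variable (K q) in
/-- The expansion of `1 / y` at the place at infinity in the local parameter `t = x / y`: it
satisfies `w ^ q + w = t ^ (q + 1)`. -/
def invYSeries : LaurentSeries K :=
  HahnSeries.ofPowerSeries ℤ K (solve q (PowerSeries.X ^ (q + 1)))

variable (K q) in
/-- The local parameter `t = x / y` at infinity. -/
def tInfty : LaurentSeries K := HahnSeries.ofPowerSeries ℤ K PowerSeries.X

variable (K q) in
theorem invYSeries_spec :
    (invYSeries K q)⁻¹ ^ q + (invYSeries K q)⁻¹ = (tInfty K * (invYSeries K q)⁻¹) ^ (q + 1) := by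
  have hc : PowerSeries.constantCoeff ((PowerSeries.X : PowerSeries K) ^ (q + 1)) = 0 := by simp
  have h := congrArg (HahnSeries.ofPowerSeries ℤ K) (solve_spec (q := q) hc)
  rw [map_add, map_pow, map_pow] at h
  have h0 : invYSeries K q ≠ 0 := by
    intro h0
    exact solve_ne_zero (q := q) hc (pow_ne_zero _ PowerSeries.X_ne_zero)
      (HahnSeries.ofPowerSeries_injective (h0.trans (map_zero _).symm))
  change invYSeries K q ^ q + invYSeries K q = tInfty K ^ (q + 1) at h
  rw [mul_pow, ← h, pow_succ ((invYSeries K q)⁻¹)]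
  have h1 := mul_inv_cancel₀ h0
  have h2 : invYSeries K q ^ q * (invYSeries K q)⁻¹ ^ q = 1 := by rw [← mul_pow, h1, one_pow]
  linear_combination -(invYSeries K q)⁻¹ * h2 - (invYSeries K q)⁻¹ ^ q * h1

variable (K q) in
/-- The expansion of the functions in `𝓡` at the place at infinity as Laurent series in the
local parameter `t = x / y`. -/
def expansionAtInfty : FunRing K q →+* LaurentSeries K :=
  liftXY (tInfty K * (invYSeries K q)⁻¹) (invYSeries K q)⁻¹ (invYSeries_spec K q)

open Classical in
/-- The pole order `-v(f)` of `f ∈ 𝓡` at the place at infinity, with value `-∞` at `0`. -/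
def ord (f : FunRing K q) : WithBot ℤ :=
  if f = 0 then ⊥ else ((-(expansionAtInfty K q f).order : ℤ) : WithBot ℤ)

/-- `ord_m Q`, the maximum of `ord Q_t + t * m` over the coefficients `Q_t` of `z ^ t`. -/
def ordZ (m : ℕ) (Q : (FunRing K q)[X]) : WithBot ℤ :=
  Q.support.sup fun t => ord (Q.coeff t) + (((t * m : ℕ) : ℤ) : WithBot ℤ)

/-! ### The interpolation module and its generators -/

/-- The Guruswami–Sudan module: all `Q ∈ 𝓡[z]` of `z`-degree at most `ℓ` with a zero of
multiplicity at least `s` at `(P, r P)` for all affine places `P`. -/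
def gsModule (s ℓ : ℕ) (r : AffinePlace K q → K) :
    Submodule (FunRing K q) (FunRing K q)[X] where
  carrier := {Q | Q.degree ≤ ℓ ∧ ∀ P, HasZeroOfMult s P (r P) Q}
  zero_mem' := ⟨by simp, fun P j h _ => by simp⟩
  add_mem' := fun {Q Q'} hQ hQ' => ⟨(degree_add_le _ _).trans (max_le hQ.1 hQ'.1),
    fun P j h hjh => by
      rw [Polynomial.map_add, map_add, coeff_add, map_add, hQ.2 P j h hjh, hQ'.2 P j h hjh,
        add_zero]⟩
  smul_mem' := fun a Q hQ => ⟨(degree_smul_le a Q).trans hQ.1, fun P j h hjh => by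
    rw [Polynomial.map_smul, map_smul, coeff_smul, smul_eq_mul, PowerSeries.coeff_mul]
    refine Finset.sum_eq_zero fun i hi => ?_
    have := Finset.HasAntidiagonal.mem_antidiagonal.1 hi
    rw [hQ.2 P i.2 h (by omega), mul_zero]⟩

variable (K q) in
/-- `G = x ^ (q ^ 2) - x`. -/
def G : FunRing K q := x K q ^ (q ^ 2) - x K q

/-- The polynomials `H^(t)`. -/
def H (s : ℕ) (R : FunRing K q) (t : ℕ) : (FunRing K q)[X] :=
  if t ≤ s then C (G K q ^ (s - t)) * (X - C R) ^ t else X ^ (t - s) * (X - C R) ^ s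

/-! ### Vectorisation -/

/-- The coordinates `(g_0, …, g_{q-1})` of `g = ∑ j < q, g_j(x) * y ^ j`. -/
def vec : FunRing K q →ₗ[K[X]] (Fin q → K[X]) :=
  LinearMap.pi fun j =>
    (lcoeff K[X] (j : ℕ)).comp (AdjoinRoot.modByMonicHom (curve_monic K q))

/-- The vectorisation of `Q ∈ 𝓡[z]` of `z`-degree at most `ℓ`; the block `t` consists of the
coordinates of the coefficient of `z ^ t`. -/
def vecZ (ℓ : ℕ) : (FunRing K q)[X] →ₗ[K[X]] (Fin (ℓ + 1) × Fin q → K[X]) where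
  toFun Q := fun i => vec (Q.coeff i.1) i.2
  map_add' Q Q' := by ext1 i; simp
  map_smul' a Q := by ext1 i; simp

/-- The matrix `A_{s,ℓ}` with rows the vectorisations of `y ^ j * H^(t)`. -/
def gsMatrix (s ℓ : ℕ) (R : FunRing K q) :
    Matrix (Fin (ℓ + 1) × Fin q) (Fin (ℓ + 1) × Fin q) K[X] :=
  Matrix.of fun i => vecZ ℓ (C (y K q ^ (i.2 : ℕ)) * H s R i.1)

end

/-- The `K[x]`-row space of a matrix. -/
def rowSpace {ι κ : Type*} (A : Matrix ι κ K[X]) : Submodule K[X] (κ → K[X]) :=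
  Submodule.span K[X] (Set.range A.row)

/-! ### Weighted degrees -/

/-- The degree `max_i deg v_i` of a vector. -/
def vecDegree {ι : Type*} [Fintype ι] (v : ι → K[X]) : WithBot ℕ :=
  Finset.univ.sup fun i => (v i).degree

/-- The map `v ↦ (x ^ (w_i) * v_i(x ^ ν))_i`. -/
def weightMap {ι : Type*} (ν : ℕ) (w : ι → ℕ) (v : ι → K[X]) : ι → K[X] :=
  fun i => X ^ w i * expand K ν (v i)

/-- The weight vector, with entry `t * m + j * (q + 1)` at position `j` of block `t`. -/
def gsWeight (q m ℓ : ℕ) : Fin (ℓ + 1) × Fin q → ℕ :=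
  fun i => (i.1 : ℕ) * m + (i.2 : ℕ) * (q + 1)

/-- The weighted degree of a vector, for the weights `(q, gsWeight q m ℓ)`. -/
def weightedDegree (m ℓ : ℕ) (v : Fin (ℓ + 1) × Fin q → K[X]) : WithBot ℕ :=
  vecDegree (weightMap q (gsWeight q m ℓ) v)

end

end Hermitian

namespace Hermitian

section

variable {K : Type*} [Field K] {q : ℕ}

/-! ### The values of `liftXY` -/

/-! The multiplicity condition at `(P, r P)` is a condition on the expansion in powers of `z - r P`.
As `R` takes the value `r P` at `P`, expanding in powers of `z - R` instead gives the same condition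
(`hasZeroOfMult_iff`): the coefficient of index `h` must vanish to order `s - h` at every affine
place. `G` has a simple zero at each affine place, and a function vanishing at all of them is a
multiple of `G` (`G_dvd_of_evalAt_eq_zero`), so the condition says that `G ^ (s - h)` divides that
coefficient (`mem_gsModule_iff`). Hence the `H^(t)` generate the module over `𝓡`, and the `y ^ j *
H^(t)` with `j < q` generate it over `K[x]`, which gives `vecZ_bijOn`.

At infinity `x` and `y` have pole orders `q` and `q + 1`. The pole orders of the monomials `x ^ i *
y ^ j` with `j < q` are pairwise distinct, so nothing cancels and `ord` is the maximum over the
terms. Thus `ord_m` is the weighted degree of the vectorisation (`ordZ_eq_weightedDegree`), and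
minimality transfers along the bijection. -/

@[simp] theorem liftXY_of {S : Type*} [CommRing S] [Algebra K S] {a b : S}
    (h : b ^ q + b = a ^ (q + 1)) (p : K[X]) :
    liftXY a b h (AdjoinRoot.of (curve K q) p) = aeval a p :=
  AdjoinRoot.lift_of _

@[simp] theorem liftXY_x {S : Type*} [CommRing S] [Algebra K S] {a b : S}
    (h : b ^ q + b = a ^ (q + 1)) : liftXY a b h (x K q) = a := by
  rw [x, liftXY_of, aeval_X]

@[simp] theorem liftXY_y {S : Type*} [CommRing S] [Algebra K S] {a b : S}
    (h : b ^ q + b = a ^ (q + 1)) : liftXY a b h (y K q) = b :=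
  AdjoinRoot.lift_root _

theorem constantCoeff_solve {c : PowerSeries K} (hc : PowerSeries.constantCoeff c = 0) :
    PowerSeries.constantCoeff (solve q c) = 0 := by
  rw [← PowerSeries.coeff_zero_eq_constantCoeff_apply, solve, PowerSeries.coeff_mk,
    PowerSeries.coeff_zero_eq_constantCoeff_apply]
  simp [hc]

end

section

variable {K : Type*} [Field K] [Finite K] {q : ℕ} [hK : Fact (Nat.card K = q ^ 2)]

theorem pow_q_sq (a : K) : a ^ (q ^ 2) = a := by
  have := Fintype.ofFinite K
  rw [← hK.out, Nat.card_eq_fintype_card, FiniteField.pow_card]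

/-! ### Coordinates with respect to the powers of `y` -/

/-- The curve polynomial is monic of degree `q` in `Y`, so the remainder modulo it represents `f`
with `Y`-degree below `q`. -/
theorem sum_vec (f : FunRing K q) :
    f = ∑ j : Fin q, AdjoinRoot.of (curve K q) (vec f j) * y K q ^ (j : ℕ) := by
  set g := AdjoinRoot.modByMonicHom (curve_monic K q) f with hg
  have hf : f = AdjoinRoot.mk (curve K q) g := (AdjoinRoot.mk_leftInverse _ f).symm
  have hdeg : g.natDegree < q := by
    obtain ⟨p, rfl⟩ := AdjoinRoot.mk_surjective f
    rw [hg, AdjoinRoot.modByMonicHom_mk]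
    have := one_lt_q K q
    have h := natDegree_modByMonic_lt p (curve_monic K q) fun h => by
      have h2 := curve_natDegree K q
      rw [h, natDegree_one] at h2
      omega
    rwa [curve_natDegree K q] at h
  conv_lhs => rw [hf, as_sum_range_C_mul_X_pow' g hdeg]
  rw [map_sum, Finset.sum_range]
  refine Finset.sum_congr rfl fun j _ => ?_
  rw [map_mul, map_pow, AdjoinRoot.mk_X, AdjoinRoot.mk_C]
  rfl

theorem vec_injective : Function.Injective (vec : FunRing K q → Fin q → K[X]) := by
  intro f g h
  rw [sum_vec f, sum_vec g, h]

theorem vec_eq_zero_iff {f : FunRing K q} : vec f = 0 ↔ f = 0 :=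
  map_eq_zero_iff vec vec_injective

/-- The degree bound is essential: `vecZ ℓ` ignores the coefficients of index above `ℓ`. -/
theorem vecZ_injOn (ℓ : ℕ) :
    Set.InjOn (vecZ (K := K) (q := q) ℓ) {Q | Q.degree ≤ ℓ} := by
  intro Q hQ Q' hQ' h
  ext1 t
  by_cases ht : t ≤ ℓ
  · refine vec_injective (funext fun j => ?_)
    exact congrFun h (⟨t, by omega⟩, j)
  · have ht : (ℓ : WithBot ℕ) < t := by exact_mod_cast not_le.1 ht
    rw [coeff_eq_zero_of_degree_lt (lt_of_le_of_lt hQ ht),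
      coeff_eq_zero_of_degree_lt (lt_of_le_of_lt hQ' ht)]

/-! ### Functions that vanish at all affine places -/

/-- The norm `α ^ (q + 1)` is fixed by the `q`-th power map, so `T = X ^ q + X - C (α ^ (q + 1))`
satisfies `T ^ q - T = X ^ (q ^ 2) - X`. Hence `T` divides a polynomial that splits with simple
roots: there are exactly `q` affine points above each `α`. -/
theorem card_roots_trace (α : K) :
    Multiset.card (X ^ q + X - C (α ^ (q + 1)) : K[X]).roots = q ∧
      (X ^ q + X - C (α ^ (q + 1)) : K[X]).roots.Nodup := by
  have := Fintype.ofFinite K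
  have hq := one_lt_q K q
  set T : K[X] := X ^ q + X - C (α ^ (q + 1)) with hT
  have hdeg : T.natDegree = q := by
    rw [hT, add_sub_assoc, natDegree_add_eq_left_of_natDegree_lt]
    · exact natDegree_X_pow q
    · rw [natDegree_X_pow, natDegree_X_sub_C]; exact hq
  have hc : (C (α ^ (q + 1)) : K[X]) ^ q = C (α ^ (q + 1)) := by
    rw [← C_pow, ← pow_mul, add_mul, one_mul, ← sq, pow_add, pow_q_sq, pow_succ', mul_comm]
  have hdvd : T ∣ X ^ Fintype.card K - X := by
    have e : T * (T ^ (q - 1) - 1) = X ^ Fintype.card K - X := by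
      rw [← Nat.card_eq_fintype_card, hK.out, mul_sub, mul_one, ← pow_succ',
        Nat.sub_add_cancel hq.le]
      conv_lhs => rw [hT]
      rw [sub_eq_add_neg (X ^ q + X), add_pow_q K q, add_pow_q K q, neg_pow_q K q, hc, ← pow_mul,
        ← sq]
      ring
    exact ⟨_, e.symm⟩
  have hne := FiniteField.X_pow_card_sub_X_ne_zero K (Fintype.one_lt_card (α := K))
  have hroots := FiniteField.roots_X_pow_card_sub_X K
  have hle := roots.le_of_dvd hne hdvd
  have hsplit : (X ^ Fintype.card K - X : K[X]).Splits := by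
    rw [splits_iff_card_roots, hroots,
      FiniteField.X_pow_card_sub_X_natDegree_eq K Fintype.one_lt_card]
    rfl
  refine ⟨?_, ?_⟩
  · rw [← (hsplit.of_dvd hne hdvd).natDegree_eq_card_roots, hdeg]
  · rw [hroots] at hle
    exact Multiset.nodup_of_le hle Finset.univ.nodup

/-- For fixed `α`, the polynomial `∑ f_i(α) Y ^ i` has degree below `q` and vanishes at the `q`
ordinates above `α`, so it is zero. Each coordinate `f_i` therefore vanishes on all of `K` and is
divisible by `∏ (X - a) = X ^ (q ^ 2) - X`. -/
theorem G_dvd_of_evalAt_eq_zero {f : FunRing K q} (hf : ∀ P : AffinePlace K q, evalAt P f = 0) :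
    G K q ∣ f := by
  classical
  have := Fintype.ofFinite K
  have hq := one_lt_q K q
  have hα : ∀ (j : Fin q) (α : K), (vec f j).eval α = 0 := by
    intro j α
    obtain ⟨hcard, hnd⟩ := card_roots_trace (q := q) α
    set p : K[X] := ∑ i : Fin q, monomial (i : ℕ) ((vec f i).eval α) with hp
    have hp0 : p = 0 := by
      refine eq_zero_of_natDegree_lt_card_of_eval_eq_zero' p
        (X ^ q + X - C (α ^ (q + 1)) : K[X]).roots.toFinset ?_ ?_
      · intro β hβ
        have hβ' := (mem_roots'.1 (Multiset.mem_toFinset.1 hβ)).2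
        have hβ' : β ^ q + β = α ^ (q + 1) := by
          simpa [IsRoot, sub_eq_zero] using hβ'
        have h := hf ⟨(α, β), hβ'⟩
        rw [sum_vec f, map_sum] at h
        rw [hp, eval_finsetSum, ← h]
        refine Finset.sum_congr rfl fun i _ => ?_
        rw [eval_monomial, map_mul, map_pow, evalAt, liftXY_of, liftXY_y, coe_aeval_eq_eval]
      · rw [Multiset.toFinset_card_of_nodup hnd, hcard]
        have : p.degree < q := by
          refine (degree_sum_le _ _).trans_lt ?_
          rw [Finset.sup_lt_iff (WithBot.bot_lt_coe _)]
          intro i _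
          exact (degree_monomial_le _ _).trans_lt (by exact_mod_cast i.2)
        by_cases h0 : p = 0
        · rw [h0, natDegree_zero]; omega
        · exact (natDegree_lt_iff_degree_lt h0).2 this
    have := congrArg (fun r => coeff r (j : ℕ)) hp0
    simpa [hp, finsetSum_coeff, coeff_monomial, Fin.val_inj] using this
  have hdvd : ∀ j : Fin q, (X ^ (q ^ 2) - X : K[X]) ∣ vec f j := by
    intro j
    have e : (X ^ (q ^ 2) - X : K[X]) = ∏ a : K, (X - C a) := by
      have h := FiniteField.roots_X_pow_card_sub_X K
      have hm : (X ^ Fintype.card K - X : K[X]).Monic := by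
        have := Fintype.one_lt_card (α := K)
        rw [sub_eq_add_neg]
        refine monic_X_pow_add ?_
        rw [degree_neg, degree_X]
        exact_mod_cast this
      rw [← hK.out, Nat.card_eq_fintype_card]
      have h2 := prod_multiset_X_sub_C_of_monic_of_roots_card_eq hm (by
        rw [h, FiniteField.X_pow_card_sub_X_natDegree_eq K Fintype.one_lt_card]; rfl)
      rw [h] at h2
      exact h2.symm
    rw [e]
    refine Finset.prod_dvd_of_coprime ?_ fun a _ => dvd_iff_isRoot.2 (hα j a)
    intro a _ b _ hab
    exact isCoprime_X_sub_C_of_isUnit_sub (sub_ne_zero.2 hab).isUnit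
  rw [sum_vec f]
  refine Finset.dvd_sum fun j _ => Dvd.dvd.mul_right ?_ _
  have := map_dvd (AdjoinRoot.of (curve K q)) (hdvd j)
  rwa [map_sub, map_pow] at this

/-! ### Local expansions at the affine places and powers of `G` -/

theorem constantCoeff_expansionAt (P : AffinePlace K q) (f : FunRing K q) :
    PowerSeries.constantCoeff (expansionAt P f) = evalAt P f := by
  have hy : PowerSeries.constantCoeff (ySeries P) = P.1.2 := by
    rw [ySeries, map_add, constantCoeff_solve (by simp)]
    simp
  have hx : ∀ p : K[X], PowerSeries.constantCoeff
      (aeval (PowerSeries.C P.1.1 + PowerSeries.X : PowerSeries K) p) = aeval P.1.1 p := by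
    intro p
    induction p using Polynomial.induction_on' with
    | add p p' h h' => simp [h, h']
    | monomial n a => simp [aeval_monomial]
  conv_lhs => rw [sum_vec f]
  conv_rhs => rw [sum_vec f]
  simp only [map_sum, map_mul, map_pow, expansionAt, evalAt, liftXY_of, liftXY_y, hy, hx]

/-- Since `α ^ (q ^ 2) = α`, the expansion is `φ ^ (q ^ 2) - φ`. The cofactor of `φ` is a unit, so
`G` has a simple zero at `P`. -/
theorem expansionAt_G (P : AffinePlace K q) :
    expansionAt P (G K q) =
      PowerSeries.X * (PowerSeries.X ^ (q ^ 2 - 1) - 1 : PowerSeries K) := by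
  have hq : 0 < q ^ 2 := by have := one_lt_q K q; positivity
  have h : (PowerSeries.C P.1.1 : PowerSeries K) ^ q ^ 2 = PowerSeries.C P.1.1 := by
    rw [← map_pow, pow_q_sq]
  rw [G, map_sub, map_pow, expansionAt, liftXY_x, mul_sub, ← pow_succ', Nat.sub_add_cancel hq,
    sq q, pow_mul, add_pow_q K q, add_pow_q K q, ← pow_mul, ← pow_mul, ← sq, h]
  ring

theorem isUnit_X_pow_sub_one :
    IsUnit (PowerSeries.X ^ (q ^ 2 - 1) - 1 : PowerSeries K) := by
  have hq := one_lt_q K q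
  have : q ^ 2 - 1 ≠ 0 := by
    have : 1 < q ^ 2 := Nat.one_lt_pow two_ne_zero hq
    omega
  rw [PowerSeries.isUnit_iff_constantCoeff]
  simp [this]

/-- Local to global, one factor at a time: vanishing at all places yields a factor `G`, and
cancelling `φ` times a unit lowers the order required of the quotient by one. -/
theorem G_pow_dvd_iff (k : ℕ) (f : FunRing K q) :
    G K q ^ k ∣ f ↔
      ∀ P : AffinePlace K q, (PowerSeries.X : PowerSeries K) ^ k ∣ expansionAt P f := by
  constructor
  · intro h P
    refine Dvd.dvd.trans ?_ (map_dvd (expansionAt P) h)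
    rw [map_pow, expansionAt_G, mul_pow]
    exact dvd_mul_right _ _
  · induction k generalizing f with
    | zero => simp
    | succ k ih =>
      intro h
      obtain ⟨g, rfl⟩ := G_dvd_of_evalAt_eq_zero (f := f) fun P => by
        rw [← constantCoeff_expansionAt, ← PowerSeries.X_dvd_iff]
        exact (dvd_pow_self _ k.succ_ne_zero).trans (h P)
      rw [pow_succ']
      refine mul_dvd_mul_left _ (ih g fun P => ?_)
      have := h P
      rw [map_mul, expansionAt_G, pow_succ', mul_assoc] at this
      have := (mul_dvd_mul_iff_left PowerSeries.X_ne_zero).1 this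
      exact (isUnit_X_pow_sub_one (K := K) (q := q)).dvd_mul_left.1 this

/-! ### Zeros of given multiplicity -/

/-- A shift by a multiple of `φ` preserves the condition that the coefficient of index `h` is
divisible by `φ ^ (s - h)`. -/
theorem pow_dvd_coeff_taylor {S : Type*} [CommRing S] {φ d : S} (hd : φ ∣ d) {s : ℕ} {p : S[X]}
    (hp : ∀ h, φ ^ (s - h) ∣ p.coeff h) (h : ℕ) : φ ^ (s - h) ∣ (taylor d p).coeff h := by
  rw [taylor_coeff, eval_eq_sum_range]
  refine Finset.dvd_sum fun i _ => ?_
  rw [hasseDeriv_coeff, mul_assoc]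
  refine Dvd.dvd.mul_left ?_ _
  refine Dvd.dvd.trans ?_ (mul_dvd_mul (hp (i + h)) (pow_dvd_pow_of_dvd hd i))
  rw [← pow_add]
  -- The factor `d ^ i` restores the at most `i` powers of `φ` lost in passing from index `h` to `i
  -- + h`.
  exact pow_dvd_pow _ (by omega)

/-- Truncated subtraction makes the condition vacuous for `h ≥ s`, as it should be. -/
theorem hasZeroOfMult_iff_dvd (s : ℕ) (P : AffinePlace K q) (z₀ : K) (Q : (FunRing K q)[X]) :
    HasZeroOfMult s P z₀ Q ↔ ∀ h, (PowerSeries.X : PowerSeries K) ^ (s - h) ∣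
      (taylor (PowerSeries.C z₀) (Q.map (expansionAt P))).coeff h := by
  simp only [HasZeroOfMult, PowerSeries.X_pow_dvd_iff]
  exact ⟨fun H h j hj => H j h (by omega), fun H j h hj => H h j (by omega)⟩

/-- The expansion of `R` at `P` differs from its value by a multiple of `φ`, so
`pow_dvd_coeff_taylor` applies to the shift in both directions. -/
theorem hasZeroOfMult_iff (s : ℕ) (P : AffinePlace K q) (R : FunRing K q)
    (Q : (FunRing K q)[X]) :
    HasZeroOfMult s P (evalAt P R) Q ↔ ∀ h, (PowerSeries.X : PowerSeries K) ^ (s - h) ∣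
      expansionAt P ((taylor R Q).coeff h) := by
  have hd : (PowerSeries.X : PowerSeries K) ∣
      expansionAt P R - PowerSeries.C (evalAt P R) := by
    rw [PowerSeries.X_dvd_iff, map_sub, constantCoeff_expansionAt]
    simp
  simp only [hasZeroOfMult_iff_dvd, ← coeff_map, map_taylor]
  constructor
  · intro H h
    have := pow_dvd_coeff_taylor hd H h
    rwa [taylor_taylor, sub_add_cancel] at this
  · intro H h
    have := pow_dvd_coeff_taylor (dvd_neg.2 hd) H h
    rwa [taylor_taylor, neg_sub, sub_add_cancel] at this

theorem mem_gsModule_iff {s ℓ : ℕ} {r : AffinePlace K q → K} {R : FunRing K q}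
    (hR : ∀ P, evalAt P R = r P) {Q : (FunRing K q)[X]} :
    Q ∈ gsModule s ℓ r ↔
      Q.degree ≤ ℓ ∧ ∀ h, G K q ^ (s - h) ∣ (taylor R Q).coeff h := by
  change (Q.degree ≤ ℓ ∧ ∀ P, HasZeroOfMult s P (r P) Q) ↔ _
  simp only [← hR, hasZeroOfMult_iff, G_pow_dvd_iff]
  exact and_congr_right fun _ => forall_comm

end

section

variable {K : Type*} [Field K] {q : ℕ}

/-! ### The generators of the interpolation module -/

theorem degree_H_le {s ℓ t : ℕ} (R : FunRing K q) (ht : t ≤ ℓ) :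
    (H s R t).degree ≤ ℓ := by
  have h1 (n : ℕ) : ((X - C R : (FunRing K q)[X]) ^ n).natDegree ≤ n :=
    natDegree_pow_le_of_le n (natDegree_X_sub_C_le R) |>.trans (by simp)
  refine degree_le_of_natDegree_le ?_
  unfold H
  split_ifs with h
  · exact (natDegree_C_mul_le _ _).trans ((h1 t).trans ht)
  · refine (natDegree_mul_le_of_le (natDegree_X_pow_le _) (h1 s)).trans ?_
    omega

variable [Finite K] [hK : Fact (Nat.card K = q ^ 2)]

/-- Under `z ↦ z + R` the generators become `G ^ (s - t) * z ^ t` and `(z + R) ^ (t - s) * z ^ s`,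
where the divisibility is visible. -/
theorem H_mem_gsModule {s ℓ t : ℕ} {r : AffinePlace K q → K} {R : FunRing K q}
    (hR : ∀ P, evalAt P R = r P) (ht : t ≤ ℓ) : H s R t ∈ gsModule s ℓ r := by
  refine (mem_gsModule_iff hR).2 ⟨degree_H_le R ht, fun h => ?_⟩
  unfold H
  split_ifs with hts
  · rw [taylor_mul, taylor_C, taylor_pow, map_sub, taylor_X, taylor_C, add_sub_cancel_right,
      coeff_C_mul, coeff_X_pow]
    split_ifs with hh
    · rw [hh, mul_one]
    · simp
  · rw [taylor_mul, taylor_pow _ (X - C R), map_sub, taylor_X, taylor_C, add_sub_cancel_right,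
      coeff_mul_X_pow']
    split_ifs with hh
    · rw [Nat.sub_eq_zero_of_le hh, pow_zero]
      exact one_dvd _
    · exact dvd_zero _

/-- Writing `c` in powers of `y` over `K[x]` turns an `𝓡`-multiple of `H^(t)` into a
`K[x]`-combination of rows. -/
theorem vecZ_C_mul_H_mem_rowSpace {s ℓ t : ℕ} (R c : FunRing K q) (ht : t ≤ ℓ) :
    vecZ ℓ (C c * H s R t) ∈ rowSpace (gsMatrix s ℓ R) := by
  have e : C c * H s R t = ∑ j : Fin q, vec c j • (C (y K q ^ (j : ℕ)) * H s R t) := by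
    conv_lhs => rw [sum_vec c]
    rw [map_sum, Finset.sum_mul]
    refine Finset.sum_congr rfl fun j _ => ?_
    rw [map_mul, mul_assoc, ← smul_eq_C_mul]
    exact algebraMap_smul (FunRing K q) (vec c j) _
  rw [e, map_sum]
  refine Submodule.sum_mem _ fun j _ => ?_
  rw [map_smul]
  exact Submodule.smul_mem _ _ (Submodule.subset_span ⟨(⟨t, by omega⟩, j), rfl⟩)

theorem vecZ_mem_rowSpace {s ℓ : ℕ} {r : AffinePlace K q → K} {R : FunRing K q}
    (hR : ∀ P, evalAt P R = r P) (hsℓ : s ≤ ℓ) {Q : (FunRing K q)[X]}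
    (hQ : Q ∈ gsModule s ℓ r) : vecZ ℓ Q ∈ rowSpace (gsMatrix s ℓ R) := by
  obtain ⟨hdeg, hdvd⟩ := (mem_gsModule_iff hR).1 hQ
  have hlt : (taylor R Q).natDegree < ℓ + 1 := by
    rw [natDegree_taylor]
    exact Nat.lt_succ_of_le (natDegree_le_of_degree_le hdeg)
  -- Each term of the expansion in powers of `z - R` is treated separately.
  rw [← sum_taylor_eq Q R, sum_over_range' _ (by simp) _ hlt, map_sum]
  refine Submodule.sum_mem _ fun t ht => ?_
  have ht : t ≤ ℓ := Nat.le_of_lt_succ (Finset.mem_range.1 ht)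
  by_cases hts : t ≤ s
  · obtain ⟨d, hd⟩ := hdvd t
    have e : C ((taylor R Q).coeff t) * (X - C R) ^ t = C d * H s R t := by
      rw [H, if_pos hts, hd, mul_comm (G K q ^ _), map_mul, mul_assoc]
    rw [e]
    exact vecZ_C_mul_H_mem_rowSpace R d ht
  -- Above index `s`, only the factor `(z - R) ^ (t - s)` is rewritten in powers of `z`; each `z ^ i
  -- * (z - R) ^ s` is then a generator.
  · have hU : (C ((taylor R Q).coeff t) * (X - C R) ^ (t - s)).natDegree < ℓ - s + 1 := by
      refine Nat.lt_succ_of_le ((natDegree_C_mul_le _ _).trans ?_)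
      refine (natDegree_pow_le_of_le _ (natDegree_X_sub_C_le R)).trans ?_
      omega
    have e : C ((taylor R Q).coeff t) * (X - C R) ^ t =
        C ((taylor R Q).coeff t) * (X - C R) ^ (t - s) * (X - C R) ^ s := by
      rw [mul_assoc, ← pow_add, Nat.sub_add_cancel (not_le.1 hts).le]
    rw [e, as_sum_range_C_mul_X_pow' _ hU, Finset.sum_mul, map_sum]
    refine Submodule.sum_mem _ fun i hi => ?_
    have hi : i + s ≤ ℓ := by have := Finset.mem_range.1 hi; omega
    have e' : X ^ i * (X - C R) ^ s = H s R (i + s) := by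
      unfold H
      split_ifs with h
      · obtain rfl : i = 0 := by omega
        simp
      · rw [Nat.add_sub_cancel]
    rw [mul_assoc, e']
    exact vecZ_C_mul_H_mem_rowSpace R _ hi

theorem exists_of_mem_rowSpace {s ℓ : ℕ} {r : AffinePlace K q → K} {R : FunRing K q}
    (hR : ∀ P, evalAt P R = r P) {v : Fin (ℓ + 1) × Fin q → K[X]}
    (hv : v ∈ rowSpace (gsMatrix s ℓ R)) : ∃ Q ∈ gsModule s ℓ r, vecZ ℓ Q = v := by
  have hle : rowSpace (gsMatrix s ℓ R) ≤
      ((gsModule s ℓ r).restrictScalars K[X]).map (vecZ ℓ) := by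
    refine Submodule.span_le.2 ?_
    rintro _ ⟨i, rfl⟩
    refine ⟨_, ?_, rfl⟩
    rw [← smul_eq_C_mul]
    exact (gsModule s ℓ r).smul_mem _ (H_mem_gsModule hR (Nat.le_of_lt_succ i.1.2))
  exact hle hv

theorem vecZ_bijOn {s ℓ : ℕ} {r : AffinePlace K q → K} {R : FunRing K q}
    (hR : ∀ P, evalAt P R = r P) (hsℓ : s ≤ ℓ) :
    Set.BijOn (vecZ (K := K) (q := q) ℓ) (gsModule s ℓ r : Set (FunRing K q)[X])
      (rowSpace (gsMatrix s ℓ R) : Set (Fin (ℓ + 1) × Fin q → K[X])) :=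
  ⟨fun _ hQ => vecZ_mem_rowSpace hR hsℓ hQ, (vecZ_injOn ℓ).mono fun _ hQ => hQ.1,
    fun _ hv => exists_of_mem_rowSpace hR hv⟩

end

/-! ### Pole orders at infinity -/

/-- The value of a sum whose non-zero terms have distinct values is the minimum of the values. -/
theorem addValuation_sum_eq_inf {S ι Γ : Type*} [Ring S] [LinearOrderedAddCommMonoidWithTop Γ]
    (v : AddValuation S Γ) (s : Finset ι) (f : ι → S)
    (h : ∀ i ∈ s, ∀ j ∈ s, v (f i) = v (f j) → v (f i) ≠ ⊤ → i = j) :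
    v (∑ i ∈ s, f i) = s.inf fun i => v (f i) := by
  classical
  induction s using Finset.induction_on with
  | empty => simp
  | insert a s ha ih =>
    have ih := ih fun i hi j hj =>
      h i (Finset.mem_insert_of_mem hi) j (Finset.mem_insert_of_mem hj)
    rw [Finset.sum_insert ha, Finset.inf_insert, ← ih]
    by_cases hv : v (f a) = v (∑ i ∈ s, f i)
    · have htop : v (f a) = ⊤ := by
        by_contra hne
        rcases s.eq_empty_or_nonempty with rfl | hs
        · simp at hv; exact hne hv
        · obtain ⟨i, hi, hi'⟩ := s.exists_mem_eq_inf hs fun i => v (f i)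
          rw [ih, hi'] at hv
          exact ha (h a (Finset.mem_insert_self a s) i (Finset.mem_insert_of_mem hi) hv hne ▸ hi)
      rw [← hv, htop, inf_idem]
      refine top_le_iff.1 ?_
      have := v.map_add (f a) (∑ i ∈ s, f i)
      rwa [← hv, htop, min_self] at this
    · exact v.map_add_of_distinct_val hv

/-- The order-reversing map `a ↦ -a`, with `⊤ ↦ ⊥`. -/
def negTop : WithTop ℤ → WithBot ℤ
  | ⊤ => ⊥
  | (n : ℤ) => ((-n : ℤ) : WithBot ℤ)

@[simp] theorem negTop_top : negTop ⊤ = ⊥ := rfl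

@[simp] theorem negTop_coe (n : ℤ) : negTop n = ((-n : ℤ) : WithBot ℤ) := rfl

theorem negTop_min (a b : WithTop ℤ) : negTop (min a b) = max (negTop a) (negTop b) := by
  cases a with
  | top => simp
  | coe a =>
    cases b with
    | top => simp
    | coe b =>
      rw [← WithTop.coe_min, negTop_coe, negTop_coe, negTop_coe, ← WithBot.coe_max, neg_inf]

theorem negTop_inf {ι : Type*} (s : Finset ι) (f : ι → WithTop ℤ) :
    negTop (s.inf f) = s.sup fun i => negTop (f i) := by
  classical
  induction s using Finset.induction_on with
  | empty => simp
  | insert a s ha ih => rw [Finset.inf_insert, Finset.sup_insert, negTop_min, ih]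

section

variable {K : Type*} [Field K]

theorem addVal_tInfty : HahnSeries.addVal ℤ K (tInfty K) = (1 : ℤ) := by
  rw [tInfty, HahnSeries.ofPowerSeries_X, HahnSeries.addVal_apply,
    HahnSeries.orderTop_single one_ne_zero]

theorem addVal_algebraMap {a : K} (ha : a ≠ 0) :
    HahnSeries.addVal ℤ K (algebraMap K (LaurentSeries K) a) = (0 : ℤ) := by
  have e : algebraMap K (LaurentSeries K) a = HahnSeries.single (0 : ℤ) a := by
    rw [HahnSeries.algebraMap_apply', PowerSeries.algebraMap_apply, HahnSeries.ofPowerSeries_C]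
    rfl
  rw [e, HahnSeries.addVal_apply, HahnSeries.orderTop_single ha]

theorem addVal_ofPowerSeries_nonneg (u : PowerSeries K) :
    (0 : WithTop ℤ) ≤ HahnSeries.addVal ℤ K (HahnSeries.ofPowerSeries ℤ K u) := by
  rw [HahnSeries.addVal_apply, HahnSeries.ofPowerSeries_apply, HahnSeries.orderTop_embDomain]
  cases (HahnSeries.toPowerSeries.symm u).orderTop with
  | top => simp
  | coe n => exact WithTop.coe_le_coe.2 (Int.natCast_nonneg n)

end

section

variable {K : Type*} [Field K] [Finite K] {q : ℕ} [hK : Fact (Nat.card K = q ^ 2)]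

/-- In `w ^ q + w = t ^ (q + 1)` with `v w ≥ 1`, the term `w ^ q` has larger value than `w`, so `v
w` is the value of the right-hand side. -/
theorem addVal_invYSeries : HahnSeries.addVal ℤ K (invYSeries K q) = ((q + 1 : ℕ) : ℤ) := by
  set c : PowerSeries K := PowerSeries.X ^ (q + 1) with hc
  have hc0 : PowerSeries.constantCoeff c = 0 := by simp [hc]
  have hq := one_lt_q K q
  set v := HahnSeries.addVal ℤ K with hv
  set w := invYSeries K q with hw
  have hspec : w ^ q + w = tInfty K ^ (q + 1) := by
    have h := congrArg (HahnSeries.ofPowerSeries ℤ K) (solve_spec (q := q) hc0)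
    rwa [map_add, map_pow, hc, map_pow] at h
  have ht : v (tInfty K ^ (q + 1)) = ((q + 1 : ℕ) : ℤ) := by
    rw [v.map_pow, addVal_tInfty, ← WithTop.coe_nsmul, nsmul_eq_mul, mul_one]
  obtain ⟨u, hu⟩ := PowerSeries.X_dvd_iff.2 (constantCoeff_solve (q := q) hc0)
  have hu : w = tInfty K * HahnSeries.ofPowerSeries ℤ K u := by
    rw [hw, invYSeries, ← hc, hu, map_mul]; rfl
  have hpos : ((1 : ℤ) : WithTop ℤ) ≤ v w := by
    rw [hu, v.map_mul, addVal_tInfty]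
    exact le_add_of_nonneg_right (addVal_ofPowerSeries_nonneg u)
  rw [← ht, ← hspec]
  symm
  refine v.map_add_eq_of_lt_right ?_
  rw [v.map_pow]
  cases h : v w with
  | top =>
    rw [v.top_iff] at h
    rw [h, zero_pow (by omega), add_zero, eq_comm, ← v.top_iff, ht] at hspec
    exact absurd hspec (WithTop.coe_ne_top)
  | coe n =>
    rw [h] at hpos
    have hn : 1 ≤ n := WithTop.coe_le_coe.1 hpos
    rw [← WithTop.coe_nsmul, WithTop.coe_lt_coe, nsmul_eq_mul]
    have : (1 : ℤ) < q := by exact_mod_cast hq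
    nlinarith

theorem addVal_expansionAtInfty_y :
    HahnSeries.addVal ℤ K (expansionAtInfty K q (y K q)) = ((-(q + 1) : ℤ) : WithTop ℤ) := by
  rw [expansionAtInfty, liftXY_y, AddValuation.map_inv, addVal_invYSeries]
  rfl

theorem addVal_expansionAtInfty_x :
    HahnSeries.addVal ℤ K (expansionAtInfty K q (x K q)) = ((-q : ℤ) : WithTop ℤ) := by
  have h := addVal_expansionAtInfty_y (K := K) (q := q)
  rw [expansionAtInfty, liftXY_y] at h
  rw [expansionAtInfty, liftXY_x, AddValuation.map_mul, addVal_tInfty, h, ← WithTop.coe_add]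
  congr 1
  ring

/-- Distinct powers of `x` have distinct values, so the leading term decides. -/
theorem addVal_expansionAtInfty_of {p : K[X]} (hp : p ≠ 0) :
    HahnSeries.addVal ℤ K (expansionAtInfty K q (AdjoinRoot.of _ p)) =
      ((-(p.natDegree * q) : ℤ) : WithTop ℤ) := by
  have hx := addVal_expansionAtInfty_x (K := K) (q := q)
  have hq : (0 : ℤ) < q := by exact_mod_cast (one_lt_q K q).trans' one_pos
  set v := HahnSeries.addVal ℤ K with hv
  set X' := expansionAtInfty K q (x K q) with hX'
  have hterm : ∀ i ∈ p.support,
      v (algebraMap K (LaurentSeries K) (p.coeff i) * X' ^ i) = ((-(i * q) : ℤ) : WithTop ℤ) := by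
    intro i hi
    rw [v.map_mul, addVal_algebraMap (mem_support_iff.1 hi), v.map_pow, hx, ← WithTop.coe_nsmul,
      ← WithTop.coe_add, nsmul_eq_mul, zero_add, mul_neg]
  have e : expansionAtInfty K q (AdjoinRoot.of _ p) =
      ∑ i ∈ p.support, algebraMap K (LaurentSeries K) (p.coeff i) * X' ^ i := by
    rw [hX', expansionAtInfty, liftXY_of, liftXY_x, aeval_eq_sum_range]
    simp only [Algebra.smul_def]
    refine (Finset.sum_subset supp_subset_range_natDegree_succ fun i _ hi => ?_).symm
    rw [notMem_support_iff.1 hi, map_zero, zero_mul]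
  rw [e, addValuation_sum_eq_inf]
  · refine le_antisymm ((Finset.inf_le (natDegree_mem_support_of_nonzero hp)).trans
      (hterm _ (natDegree_mem_support_of_nonzero hp)).le) (Finset.le_inf fun i hi => ?_)
    rw [hterm i hi, WithTop.coe_le_coe, neg_le_neg_iff]
    exact mul_le_mul_of_nonneg_right (by exact_mod_cast le_natDegree_of_mem_supp i hi) hq.le
  · intro i hi j hj hij _
    rw [hterm i hi, hterm j hj, WithTop.coe_inj, neg_inj] at hij
    exact_mod_cast mul_right_cancel₀ hq.ne' hij

/-- The degree of `x ^ n * p(x ^ q)` with values in `WithBot ℤ`. -/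
theorem map_degree_X_pow_mul_expand (n : ℕ) (p : K[X]) (hp : p ≠ 0) :
    WithBot.map (Nat.cast : ℕ → ℤ) (X ^ n * expand K q p).degree =
      ((n + p.natDegree * q : ℤ) : WithBot ℤ) := by
  have hq : 0 < q := (one_lt_q K q).trans' one_pos
  rw [degree_mul, degree_X_pow, degree_eq_natDegree ((expand_eq_zero hq).not.2 hp),
    natDegree_expand, ← Nat.cast_add]
  refine (WithBot.map_coe _ _).trans ?_
  push_cast
  rfl

theorem addVal_expansionAtInfty_term {p : K[X]} (hp : p ≠ 0) (j : ℕ) :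
    HahnSeries.addVal ℤ K (expansionAtInfty K q (AdjoinRoot.of _ p * y K q ^ j)) =
      ((-(p.natDegree * q + j * (q + 1)) : ℤ) : WithTop ℤ) := by
  rw [map_mul, map_pow, AddValuation.map_mul, AddValuation.map_pow, addVal_expansionAtInfty_of hp,
    addVal_expansionAtInfty_y, ← WithTop.coe_nsmul, ← WithTop.coe_add, nsmul_eq_mul]
  congr 1
  ring

theorem negTop_addVal_expansionAtInfty_term (p : K[X]) (j : ℕ) :
    negTop (HahnSeries.addVal ℤ K (expansionAtInfty K q (AdjoinRoot.of _ p * y K q ^ j))) =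
      WithBot.map (Nat.cast : ℕ → ℤ) (X ^ (j * (q + 1)) * expand K q p).degree := by
  by_cases hp : p = 0
  · simp [hp]
  · rw [addVal_expansionAtInfty_term hp, map_degree_X_pow_mul_expand _ _ hp, negTop_coe]
    congr 1
    push_cast
    ring

/-- The pole order of a non-zero term of index `j` is congruent to `j` modulo `q`, so for `j < q`
the terms have distinct values. -/
theorem addVal_expansionAtInfty (f : FunRing K q) :
    HahnSeries.addVal ℤ K (expansionAtInfty K q f) =
      Finset.univ.inf fun j : Fin q => HahnSeries.addVal ℤ K
        (expansionAtInfty K q (AdjoinRoot.of _ (vec f j) * y K q ^ (j : ℕ))) := by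
  conv_lhs => rw [sum_vec f, map_sum]
  refine addValuation_sum_eq_inf _ _ _ fun i _ j _ hij htop => ?_
  have hi : vec f i ≠ 0 := fun h => htop (by rw [h]; simp)
  have hj : vec f j ≠ 0 := fun h => htop (by rw [hij, h]; simp)
  rw [addVal_expansionAtInfty_term hi, addVal_expansionAtInfty_term hj, WithTop.coe_inj,
    neg_inj] at hij
  have hij : (vec f i).natDegree * q + i * (q + 1) = (vec f j).natDegree * q + j * (q + 1) := by
    exact_mod_cast hij
  have e (a b : ℕ) : a * q + b * (q + 1) = b + q * (a + b) := by ring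
  rw [e, e] at hij
  have := congrArg (· % q) hij
  simpa [Nat.add_mul_mod_self_left, Nat.mod_eq_of_lt, Fin.val_inj] using this

/-- Needed because `ord` uses `HahnSeries.order`, which takes the junk value `0` at the zero series.
-/
theorem expansionAtInfty_ne_zero {f : FunRing K q} (hf : f ≠ 0) :
    expansionAtInfty K q f ≠ 0 := by
  intro h
  refine hf (vec_eq_zero_iff.1 (funext fun j => ?_))
  by_contra hj
  have h2 := addVal_expansionAtInfty f
  rw [h, AddValuation.map_zero, eq_comm, Finset.inf_eq_top_iff] at h2
  have h3 := h2 j (Finset.mem_univ j)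
  rw [addVal_expansionAtInfty_term hj] at h3
  exact WithTop.coe_ne_top h3

theorem ord_eq_negTop (f : FunRing K q) :
    ord f = negTop (HahnSeries.addVal ℤ K (expansionAtInfty K q f)) := by
  unfold ord
  split_ifs with hf
  · simp [hf]
  · rw [HahnSeries.addVal_apply_of_ne (expansionAtInfty_ne_zero hf), negTop_coe]

theorem ord_eq_sup (f : FunRing K q) :
    ord f = Finset.univ.sup fun j : Fin q =>
      WithBot.map (Nat.cast : ℕ → ℤ) (X ^ ((j : ℕ) * (q + 1)) * expand K q (vec f j)).degree := by
  rw [ord_eq_negTop, addVal_expansionAtInfty, negTop_inf]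
  simp only [negTop_addVal_expansionAtInfty_term]

theorem ord_add_eq_sup (f : FunRing K q) (n : ℕ) :
    ord f + ((n : ℤ) : WithBot ℤ) = Finset.univ.sup fun j : Fin q =>
      WithBot.map (Nat.cast : ℕ → ℤ)
        (X ^ (n + (j : ℕ) * (q + 1)) * expand K q (vec f j)).degree := by
  have hadd (a b : WithBot ℤ) : max a b + ((n : ℤ) : WithBot ℤ) =
      max (a + ((n : ℤ) : WithBot ℤ)) (b + ((n : ℤ) : WithBot ℤ)) := max_add_add_right a b _ |>.symm
  rw [ord_eq_sup, Finset.apply_sup_eq_sup_comp (fun a : WithBot ℤ => a + ((n : ℤ) : WithBot ℤ)) hadd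
    (WithBot.bot_add _)]
  refine Finset.sup_congr rfl fun j _ => ?_
  by_cases hj : vec f j = 0
  · simp [hj]
  · rw [Function.comp_apply, map_degree_X_pow_mul_expand _ _ hj, map_degree_X_pow_mul_expand _ _ hj,
      ← WithBot.coe_add]
    congr 1
    push_cast
    ring

/-! ### The weighted degree as `ord_m` -/

theorem weightMap_vecZ_apply (m ℓ : ℕ) (Q : (FunRing K q)[X]) (i : Fin (ℓ + 1) × Fin q) :
    weightMap q (gsWeight q m ℓ) (vecZ ℓ Q) i =
      X ^ ((i.1 : ℕ) * m + (i.2 : ℕ) * (q + 1)) * expand K q (vec (Q.coeff i.1) i.2) :=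
  rfl

/-- Both sides are maxima of the same term degrees: zero coefficients contribute `⊥`, and the degree
bound ensures that no coefficient is lost. -/
theorem ordZ_eq_weightedDegree (m : ℕ) {ℓ : ℕ} {Q : (FunRing K q)[X]} (hQ : Q.degree ≤ ℓ) :
    ordZ m Q = WithBot.map (Nat.cast : ℕ → ℤ) (weightedDegree m ℓ (vecZ ℓ Q)) := by
  have hmono : Monotone (WithBot.map (Nat.cast : ℕ → ℤ)) :=
    WithBot.monotone_map_iff.2 Nat.mono_cast
  rw [weightedDegree, vecDegree,
    Finset.apply_sup_eq_sup_comp (WithBot.map (Nat.cast : ℕ → ℤ)) (fun _ _ => hmono.map_max)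
      (WithBot.map_bot _), ordZ]
  simp only [Function.comp_def, weightMap_vecZ_apply]
  refine le_antisymm (Finset.sup_le fun t ht => ?_) (Finset.sup_le fun i _ => ?_)
  · have htℓ : t < ℓ + 1 := Nat.lt_succ_of_le
      ((le_natDegree_of_mem_supp t ht).trans (natDegree_le_of_degree_le hQ))
    rw [ord_add_eq_sup]
    refine Finset.sup_le fun j _ => ?_
    exact Finset.le_sup (f := fun i : Fin (ℓ + 1) × Fin q => WithBot.map (Nat.cast : ℕ → ℤ)
      (X ^ ((i.1 : ℕ) * m + (i.2 : ℕ) * (q + 1)) * expand K q (vec (Q.coeff i.1) i.2)).degree) (Finset.mem_univ (⟨t, htℓ⟩, j))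
  · by_cases h0 : Q.coeff i.1 = 0
    · simp [h0]
    · refine le_trans ?_ (Finset.le_sup (mem_support_iff.2 h0))
      rw [ord_add_eq_sup]
      exact Finset.le_sup (f := fun j : Fin q => WithBot.map (Nat.cast : ℕ → ℤ)
        (X ^ ((i.1 : ℕ) * m + (j : ℕ) * (q + 1)) * expand K q (vec (Q.coeff i.1) j)).degree)
        (Finset.mem_univ i.2)

end

end Hermitian

/-! ### The main theorem -/

theorem mainTheorem10 {K : Type*} [Field K] [Finite K] (q : ℕ) [Fact (Nat.card K = q ^ 2)]
    (m s ℓ : ℕ) (hsℓ : s ≤ ℓ)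
    (r : Hermitian.AffinePlace K q → K)
    (R : Hermitian.FunRing K q) (hR : ∀ P, Hermitian.evalAt P R = r P) :
    Set.BijOn (Hermitian.vecZ (K := K) (q := q) ℓ)
      (Hermitian.gsModule s ℓ r : Set (Polynomial (Hermitian.FunRing K q)))
      (Hermitian.rowSpace (Hermitian.gsMatrix s ℓ R) :
        Set (Fin (ℓ + 1) × Fin q → Polynomial K)) ∧
    ∀ Q : Polynomial (Hermitian.FunRing K q), Q.degree ≤ ℓ →
      Hermitian.vecZ ℓ Q ∈ Hermitian.rowSpace (Hermitian.gsMatrix s ℓ R) →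
      Hermitian.vecZ ℓ Q ≠ 0 →
      (∀ v ∈ Hermitian.rowSpace (Hermitian.gsMatrix s ℓ R), v ≠ 0 →
        Hermitian.weightedDegree m ℓ (Hermitian.vecZ ℓ Q) ≤ Hermitian.weightedDegree m ℓ v) →
      Q ∈ Hermitian.gsModule s ℓ r ∧ Q ≠ 0 ∧
        ∀ Q' ∈ Hermitian.gsModule s ℓ r, Q' ≠ 0 →
          Hermitian.ordZ m Q ≤ Hermitian.ordZ m Q' := by
  have hbij := Hermitian.vecZ_bijOn hR hsℓ
  refine ⟨hbij, fun Q hdeg hrow hne hmin => ?_⟩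
  obtain ⟨Q₀, hQ₀, h⟩ := hbij.surjOn hrow
  -- A preimage in the module must be `Q` itself, by injectivity in degree at most `ℓ`.
  obtain rfl : Q₀ = Q := Hermitian.vecZ_injOn ℓ hQ₀.1 hdeg h
  refine ⟨hQ₀, fun h0 => hne (by rw [h0, map_zero]), fun Q' hQ' hne' => ?_⟩
  rw [Hermitian.ordZ_eq_weightedDegree m hdeg, Hermitian.ordZ_eq_weightedDegree m hQ'.1]
  refine WithBot.monotone_map_iff.2 Nat.mono_cast (hmin _ (hbij.mapsTo hQ') fun h0 => hne' ?_)
  exact hbij.injOn hQ' (Submodule.zero_mem _) (h0.trans (map_zero _).symm)
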